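/- Let $N\ge 1$, $s\in(0,1)$, $p\in(1,\infty)$, and let $\Omega\subset\mathbb{R}^N$ be a bounded domain (nonempty, open, connected) with Lipschitz boundary. Put $\mathcal{Q}=\mathbb{R}^{2N}\setminus(\mathbb{R}^N\setminus\Omega)^2$ and let $X$ be the space of measurable functions $u:\mathbb{R}^N\to\mathbb{R}$ (identified when equal almost everywhere) with $\|u\|<\infty$, where $$\|u\|=\left(\iint_{\mathcal{Q}}\frac{|u(x)-u(y)|^p}{|x-y|^{N+ps}}\,dx\,dy+\int_\Omega|u|^p\,dx\right)^{1/p},$$ normed by $\|\cdot\|$, and let $X'$ be its topological dual. Set $$[u]=\left(\iint_{\mathcal{Q}}\frac{|u(x)-u(y)|^p}{|x-y|^{N+ps}}\,dx\,dy\right)^{1/p},\qquad A(u)=[u]^p .$$ Then $A:X\to\mathbb{R}$ is (Fréchet) differentiable, and its derivative $A':X\to X'$ has the $(S)_+$ property: for every sequence $(u_n)$ in $X$ and every $u\in X$ such that $u_n\rightharpoonup u$ weakly in $X$ and $$\limsup_{n\to\infty}\,\langle A'(u_n),u_n-u\rangle_{X',X}\le 0,$$ one has $u_n\to u$ strongly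 in $X$. -/

import Mathlib

open MeasureTheory Filter Topology Set

open scoped ENNReal

namespace NeumannFrac

/-- A bounded domain of `ℝ^N` with Lipschitz boundary: near each boundary point, and in the
direction of a suitable unit vector `ν`, the set is the part of space lying strictly above the
graph of a Lipschitz function of the component orthogonal to `ν`. -/
structure LipschitzDomain (N : ℕ) where
  carrier : Set (EuclideanSpace ℝ (Fin N))
  isOpen : IsOpen carrier
  isConnected : IsConnected carrier
  isBounded : Bornology.IsBounded carrier
  lipschitz_boundary : ∀ x₀ ∈ frontier carrier,
    ∃ (r : ℝ) (ν : EuclideanSpace ℝ (Fin N)) (K : NNReal) (γ : EuclideanSpace ℝ (Fin N) → ℝ),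
      0 < r ∧ ‖ν‖ = 1 ∧ LipschitzWith K γ ∧
        ∀ x ∈ Metric.ball x₀ r,
          (x ∈ carrier ↔ γ (x - inner ℝ ν x • ν) < inner ℝ ν x)

/-- The set `𝒬 = ℝ^{2N} \ (CΩ)²`, where `CΩ = ℝ^N \ Ω`. -/
def Q {N : ℕ} (Ω : LipschitzDomain N) :
    Set (EuclideanSpace ℝ (Fin N) × EuclideanSpace ℝ (Fin N)) :=
  (Ω.carrierᶜ ×ˢ Ω.carrierᶜ)ᶜ

/-- `∬_𝒬 |u(x) - u(y)|^p / |x - y|^{N + ps} dx dy`, as an extended nonnegative number. -/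
noncomputable def gagliardoEnergy {N : ℕ} (Ω : LipschitzDomain N) (s p : ℝ)
    (u : EuclideanSpace ℝ (Fin N) → ℝ) : ℝ≥0∞ :=
  ∫⁻ z in Q Ω, ENNReal.ofReal (|u z.1 - u z.2| ^ p / ‖z.1 - z.2‖ ^ ((N : ℝ) + p * s))

/-- `∫_Ω |u|^p dx`, as an extended nonnegative number. -/
noncomputable def lpEnergy {N : ℕ} (Ω : LipschitzDomain N) (p : ℝ)
    (u : EuclideanSpace ℝ (Fin N) → ℝ) : ℝ≥0∞ :=
  ∫⁻ x in Ω.carrier, ENNReal.ofReal (|u x| ^ p)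

/-! ### Auxiliary facts: the two energies are `p`-th powers of `L^p` norms -/

/-- The weighted difference quotient `(u(x) - u(y)) / |x - y|^{(N + ps)/p}`. -/
noncomputable def quot {N : ℕ} (s p : ℝ) (u : EuclideanSpace ℝ (Fin N) → ℝ)
    (z : EuclideanSpace ℝ (Fin N) × EuclideanSpace ℝ (Fin N)) : ℝ :=
  (u z.1 - u z.2) / ‖z.1 - z.2‖ ^ (((N : ℝ) + p * s) / p)

theorem eLpNorm_rpow_eq {α : Type*} [MeasurableSpace α] (μ : Measure α) {p : ℝ} (hp : 1 < p)
    (f : α → ℝ) :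
    eLpNorm f (ENNReal.ofReal p) μ ^ p = ∫⁻ a, ENNReal.ofReal (|f a| ^ p) ∂μ := by
  have h0 : 0 < p := by linarith
  rw [eLpNorm_eq_lintegral_rpow_enorm_toReal (by simpa using h0) ENNReal.ofReal_ne_top,
    ENNReal.toReal_ofReal h0.le, ← ENNReal.rpow_mul, one_div, inv_mul_cancel₀ h0.ne',
    ENNReal.rpow_one]
  refine lintegral_congr fun a => ?_
  rw [← ENNReal.ofReal_rpow_of_nonneg (abs_nonneg _) h0.le, ← Real.norm_eq_abs,
    ofReal_norm]

theorem gagliardoEnergy_eq {N : ℕ} (Ω : LipschitzDomain N) (s : ℝ) {p : ℝ} (hp : 1 < p)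
    (u : EuclideanSpace ℝ (Fin N) → ℝ) :
    gagliardoEnergy Ω s p u
      = eLpNorm (quot s p u) (ENNReal.ofReal p) (volume.restrict (Q Ω)) ^ p := by
  have h0 : 0 < p := by linarith
  rw [eLpNorm_rpow_eq _ hp, gagliardoEnergy]
  refine lintegral_congr fun z => ?_
  have hn : (0 : ℝ) ≤ ‖z.1 - z.2‖ := norm_nonneg _
  rw [quot, abs_div, Real.div_rpow (abs_nonneg _) (abs_nonneg _),
    abs_of_nonneg (Real.rpow_nonneg hn _), ← Real.rpow_mul hn, div_mul_cancel₀ _ h0.ne']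

theorem lpEnergy_eq {N : ℕ} (Ω : LipschitzDomain N) {p : ℝ} (hp : 1 < p)
    (u : EuclideanSpace ℝ (Fin N) → ℝ) :
    lpEnergy Ω p u = eLpNorm u (ENNReal.ofReal p) (volume.restrict Ω.carrier) ^ p := by
  rw [eLpNorm_rpow_eq _ hp, lpEnergy]

theorem gagliardoEnergy_lt_top_iff {N : ℕ} (Ω : LipschitzDomain N) (s : ℝ) {p : ℝ} (hp : 1 < p)
    (u : EuclideanSpace ℝ (Fin N) → ℝ) :
    gagliardoEnergy Ω s p u < ∞
      ↔ eLpNorm (quot s p u) (ENNReal.ofReal p) (volume.restrict (Q Ω)) < ∞ := by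
  rw [gagliardoEnergy_eq Ω s hp, ENNReal.rpow_lt_top_iff_of_pos (by linarith)]

theorem lpEnergy_lt_top_iff {N : ℕ} (Ω : LipschitzDomain N) {p : ℝ} (hp : 1 < p)
    (u : EuclideanSpace ℝ (Fin N) → ℝ) :
    lpEnergy Ω p u < ∞ ↔ eLpNorm u (ENNReal.ofReal p) (volume.restrict Ω.carrier) < ∞ := by
  rw [lpEnergy_eq Ω hp, ENNReal.rpow_lt_top_iff_of_pos (by linarith)]

theorem quot_congr {N : ℕ} (s p : ℝ) {u v : EuclideanSpace ℝ (Fin N) → ℝ}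
    (h : u =ᵐ[volume] v) (S : Set (EuclideanSpace ℝ (Fin N) × EuclideanSpace ℝ (Fin N))) :
    quot s p u =ᵐ[volume.restrict S] quot s p v := by
  have h1 : ∀ᵐ z : EuclideanSpace ℝ (Fin N) × EuclideanSpace ℝ (Fin N), u z.1 = v z.1 :=
    Measure.quasiMeasurePreserving_fst.ae h
  have h2 : ∀ᵐ z : EuclideanSpace ℝ (Fin N) × EuclideanSpace ℝ (Fin N), u z.2 = v z.2 :=
    Measure.quasiMeasurePreserving_snd.ae h
  refine ae_restrict_of_ae ?_
  filter_upwards [h1, h2] with z hz1 hz2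
  simp only [quot, hz1, hz2]

theorem quot_measurable {N : ℕ} (s p : ℝ) (u : EuclideanSpace ℝ (Fin N) →ₘ[volume] ℝ) :
    Measurable (quot s p u) := by
  have hu : Measurable u := u.measurable
  unfold quot
  fun_prop

theorem quot_add {N : ℕ} (s p : ℝ) (u v : EuclideanSpace ℝ (Fin N) → ℝ) :
    quot s p (u + v) = quot s p u + quot s p v := by
  funext z
  simp only [quot, Pi.add_apply]
  ring

theorem quot_smul {N : ℕ} (s p c : ℝ) (u : EuclideanSpace ℝ (Fin N) → ℝ) :
    quot s p (c • u) = c • quot s p u := by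
  funext z
  simp only [quot, Pi.smul_apply, smul_eq_mul]
  ring

theorem quot_norm_add_le {N : ℕ} (Ω : LipschitzDomain N) (s : ℝ) {p : ℝ} (hp : 1 < p)
    (u v : EuclideanSpace ℝ (Fin N) →ₘ[volume] ℝ) :
    eLpNorm (quot s p (u + v : EuclideanSpace ℝ (Fin N) →ₘ[volume] ℝ))
        (ENNReal.ofReal p) (volume.restrict (Q Ω))
      ≤ eLpNorm (quot s p u) (ENNReal.ofReal p) (volume.restrict (Q Ω))
        + eLpNorm (quot s p v) (ENNReal.ofReal p) (volume.restrict (Q Ω)) := by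
  rw [eLpNorm_congr_ae (quot_congr s p (AEEqFun.coeFn_add u v) (Q Ω)), quot_add]
  exact eLpNorm_add_le (quot_measurable s p u).aestronglyMeasurable
    (quot_measurable s p v).aestronglyMeasurable (by simpa using hp.le)

theorem lp_norm_add_le {N : ℕ} (Ω : LipschitzDomain N) {p : ℝ} (hp : 1 < p)
    (u v : EuclideanSpace ℝ (Fin N) →ₘ[volume] ℝ) :
    eLpNorm (u + v : EuclideanSpace ℝ (Fin N) →ₘ[volume] ℝ)
        (ENNReal.ofReal p) (volume.restrict Ω.carrier)
      ≤ eLpNorm u (ENNReal.ofReal p) (volume.restrict Ω.carrier)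
        + eLpNorm v (ENNReal.ofReal p) (volume.restrict Ω.carrier) := by
  rw [eLpNorm_congr_ae (ae_restrict_of_ae (AEEqFun.coeFn_add u v))]
  exact eLpNorm_add_le u.measurable.aestronglyMeasurable
    v.measurable.aestronglyMeasurable (by simpa using hp.le)

theorem quot_norm_smul {N : ℕ} (Ω : LipschitzDomain N) (s p c : ℝ)
    (u : EuclideanSpace ℝ (Fin N) →ₘ[volume] ℝ) :
    eLpNorm (quot s p (c • u : EuclideanSpace ℝ (Fin N) →ₘ[volume] ℝ))
        (ENNReal.ofReal p) (volume.restrict (Q Ω))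
      = ‖c‖ₑ * eLpNorm (quot s p u) (ENNReal.ofReal p) (volume.restrict (Q Ω)) := by
  rw [eLpNorm_congr_ae (quot_congr s p (AEEqFun.coeFn_smul c u) (Q Ω)), quot_smul,
    eLpNorm_const_smul]

theorem lp_norm_smul {N : ℕ} (Ω : LipschitzDomain N) (p c : ℝ)
    (u : EuclideanSpace ℝ (Fin N) →ₘ[volume] ℝ) :
    eLpNorm (c • u : EuclideanSpace ℝ (Fin N) →ₘ[volume] ℝ)
        (ENNReal.ofReal p) (volume.restrict Ω.carrier)
      = ‖c‖ₑ * eLpNorm u (ENNReal.ofReal p) (volume.restrict Ω.carrier) := by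
  rw [eLpNorm_congr_ae (ae_restrict_of_ae (AEEqFun.coeFn_smul c u)), eLpNorm_const_smul]

/-! ### The space `X` -/

/-- The measurable functions `u : ℝ^N → ℝ`, up to equality almost everywhere, for which
`∬_𝒬 |u(x) - u(y)|^p / |x - y|^{N + ps} dx dy + ∫_Ω |u|^p dx` is finite. -/
def spaceXSubmodule {N : ℕ} (Ω : LipschitzDomain N) (s p : ℝ) [hp : Fact (1 < p)] :
    Submodule ℝ (EuclideanSpace ℝ (Fin N) →ₘ[volume] ℝ) where
  carrier := {u | gagliardoEnergy Ω s p u + lpEnergy Ω p u < ∞}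
  add_mem' := by
    intro u v hu hv
    simp only [mem_ofPred_eq, ENNReal.add_lt_top, gagliardoEnergy_lt_top_iff Ω s hp.out,
      lpEnergy_lt_top_iff Ω hp.out] at hu hv ⊢
    exact ⟨(quot_norm_add_le Ω s hp.out u v).trans_lt (ENNReal.add_lt_top.2 ⟨hu.1, hv.1⟩),
      (lp_norm_add_le Ω hp.out u v).trans_lt (ENNReal.add_lt_top.2 ⟨hu.2, hv.2⟩)⟩
  zero_mem' := by
    have h := quot_norm_smul Ω s p 0 (0 : EuclideanSpace ℝ (Fin N) →ₘ[volume] ℝ)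
    have h' := lp_norm_smul Ω p 0 (0 : EuclideanSpace ℝ (Fin N) →ₘ[volume] ℝ)
    rw [zero_smul, enorm_zero, zero_mul] at h h'
    simp only [mem_ofPred_eq, ENNReal.add_lt_top, gagliardoEnergy_lt_top_iff Ω s hp.out,
      lpEnergy_lt_top_iff Ω hp.out, h, h']
    simp
  smul_mem' := by
    intro c u hu
    simp only [mem_ofPred_eq, ENNReal.add_lt_top, gagliardoEnergy_lt_top_iff Ω s hp.out,
      lpEnergy_lt_top_iff Ω hp.out] at hu ⊢
    rw [quot_norm_smul, lp_norm_smul]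
    exact ⟨ENNReal.mul_lt_top enorm_lt_top hu.1, ENNReal.mul_lt_top enorm_lt_top hu.2⟩

/-- The function space `X`, normed below by
`‖u‖ = (∬_𝒬 |u(x) - u(y)|^p / |x - y|^{N + ps} dx dy + ∫_Ω |u|^p dx)^{1/p}`. -/
def SpaceX {N : ℕ} (Ω : LipschitzDomain N) (s p : ℝ) [Fact (1 < p)] : Type :=
  spaceXSubmodule Ω s p

namespace SpaceX

variable {N : ℕ} {Ω : LipschitzDomain N} {s p : ℝ} [hp : Fact (1 < p)]

noncomputable instance : AddCommGroup (SpaceX Ω s p) :=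
  inferInstanceAs (AddCommGroup (spaceXSubmodule Ω s p))

noncomputable instance : Module ℝ (SpaceX Ω s p) :=
  inferInstanceAs (Module ℝ (spaceXSubmodule Ω s p))

/-- The underlying class of functions. -/
def toFun (u : SpaceX Ω s p) : EuclideanSpace ℝ (Fin N) →ₘ[volume] ℝ := u.1

/-- `[u] = (∬_𝒬 |u(x) - u(y)|^p / |x - y|^{N + ps} dx dy)^{1/p}`. -/
noncomputable def gagliardoSeminorm (u : SpaceX Ω s p) : ℝ :=
  (gagliardoEnergy Ω s p u.toFun).toReal ^ (1 / p)

noncomputable instance : Norm (SpaceX Ω s p) where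
  norm u :=
    ((gagliardoEnergy Ω s p u.toFun).toReal + (lpEnergy Ω p u.toFun).toReal) ^ (1 / p)

theorem norm_def (u : SpaceX Ω s p) :
    ‖u‖ = ((gagliardoEnergy Ω s p u.toFun).toReal
      + (lpEnergy Ω p u.toFun).toReal) ^ (1 / p) := rfl

/-- The `L^p` norm of the weighted difference quotient. -/
noncomputable def nQ (u : SpaceX Ω s p) : ℝ :=
  (eLpNorm (quot s p u.toFun) (ENNReal.ofReal p) (volume.restrict (Q Ω))).toReal

/-- The `L^p(Ω)` norm. -/
noncomputable def nΩ (u : SpaceX Ω s p) : ℝ :=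
  (eLpNorm u.toFun (ENNReal.ofReal p) (volume.restrict Ω.carrier)).toReal

theorem finite_Q (u : SpaceX Ω s p) :
    eLpNorm (quot s p u.toFun) (ENNReal.ofReal p) (volume.restrict (Q Ω)) < ∞ :=
  (gagliardoEnergy_lt_top_iff Ω s hp.out _).1 (ENNReal.add_lt_top.1 u.2).1

theorem finite_Ω (u : SpaceX Ω s p) :
    eLpNorm u.toFun (ENNReal.ofReal p) (volume.restrict Ω.carrier) < ∞ :=
  (lpEnergy_lt_top_iff Ω hp.out _).1 (ENNReal.add_lt_top.1 u.2).2

theorem norm_eq (u : SpaceX Ω s p) : ‖u‖ = (u.nQ ^ p + u.nΩ ^ p) ^ (1 / p) := by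
  rw [norm_def, gagliardoEnergy_eq Ω s hp.out, lpEnergy_eq Ω hp.out, ← ENNReal.toReal_rpow,
    ← ENNReal.toReal_rpow]
  rfl

theorem nQ_nonneg (u : SpaceX Ω s p) : 0 ≤ u.nQ := ENNReal.toReal_nonneg

theorem nΩ_nonneg (u : SpaceX Ω s p) : 0 ≤ u.nΩ := ENNReal.toReal_nonneg

theorem nQ_add_le (u v : SpaceX Ω s p) : (u + v).nQ ≤ u.nQ + v.nQ := by
  unfold nQ
  rw [← ENNReal.toReal_add u.finite_Q.ne v.finite_Q.ne]
  exact ENNReal.toReal_mono (ENNReal.add_lt_top.2 ⟨u.finite_Q, v.finite_Q⟩).ne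
    (quot_norm_add_le Ω s hp.out u.toFun v.toFun)

theorem nΩ_add_le (u v : SpaceX Ω s p) : (u + v).nΩ ≤ u.nΩ + v.nΩ := by
  unfold nΩ
  rw [← ENNReal.toReal_add u.finite_Ω.ne v.finite_Ω.ne]
  exact ENNReal.toReal_mono (ENNReal.add_lt_top.2 ⟨u.finite_Ω, v.finite_Ω⟩).ne
    (lp_norm_add_le Ω hp.out u.toFun v.toFun)

theorem nQ_smul (c : ℝ) (u : SpaceX Ω s p) : (c • u).nQ = |c| * u.nQ := by
  have h := congrArg ENNReal.toReal (quot_norm_smul Ω s p c u.toFun)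
  rw [ENNReal.toReal_mul, toReal_enorm, Real.norm_eq_abs] at h
  exact h

theorem nΩ_smul (c : ℝ) (u : SpaceX Ω s p) : (c • u).nΩ = |c| * u.nΩ := by
  have h := congrArg ENNReal.toReal (lp_norm_smul Ω p c u.toFun)
  rw [ENNReal.toReal_mul, toReal_enorm, Real.norm_eq_abs] at h
  exact h

theorem eq_zero_of_norm_eq_zero (u : SpaceX Ω s p) (h : ‖u‖ = 0) : u = 0 := by
  have h0 : 0 < p := by linarith [hp.out]
  have hQ := Real.rpow_nonneg u.nQ_nonneg p
  have hΩ := Real.rpow_nonneg u.nΩ_nonneg p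
  rw [norm_eq, Real.rpow_eq_zero (by positivity) (by positivity)] at h
  have e1 : u.nQ = 0 := (Real.rpow_eq_zero u.nQ_nonneg h0.ne').1 (by linarith)
  have e2 : u.nΩ = 0 := (Real.rpow_eq_zero u.nΩ_nonneg h0.ne').1 (by linarith)
  have hp0 : ENNReal.ofReal p ≠ 0 := by simpa using h0
  have f1 := (ENNReal.toReal_eq_zero_iff _).1 e1 |>.resolve_right u.finite_Q.ne
  have f2 := (ENNReal.toReal_eq_zero_iff _).1 e2 |>.resolve_right u.finite_Ω.ne
  rw [eLpNorm_eq_zero_iff (quot_measurable s p _).aestronglyMeasurable hp0] at f1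
  rw [eLpNorm_eq_zero_iff u.toFun.measurable.aestronglyMeasurable hp0] at f2
  have hsub : Ω.carrier ×ˢ (univ : Set (EuclideanSpace ℝ (Fin N))) ⊆ Q Ω := by
    rintro z ⟨hz, -⟩ hz'
    exact hz'.1 hz
  have f3 := ae_restrict_of_ae_restrict_of_subset hsub f1
  rw [Measure.volume_eq_prod, ← Measure.prod_restrict, Measure.restrict_univ] at f3
  have f4 := Measure.ae_ae_of_ae_prod f3
  have hne : (ae (volume.restrict Ω.carrier)).NeBot := by
    rw [ae_neBot, Ne, Measure.restrict_eq_zero]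
    exact (Ω.isOpen.measure_pos volume Ω.isConnected.nonempty).ne'
  obtain ⟨x, hx1, hx2⟩ := (f4.and f2).exists
  have key : u.toFun = 0 := by
    apply AEEqFun.ext
    filter_upwards [hx1, AEEqFun.coeFn_zero (α := EuclideanSpace ℝ (Fin N)) (β := ℝ)
      (μ := volume)] with y hy hz
    rw [hz]
    simp only [Pi.zero_apply] at hx2 hy ⊢
    rcases div_eq_zero_iff.1 hy with h' | h'
    · simp only at h'
      linarith
    · have h'' := Real.rpow_eq_zero_iff_of_nonneg (norm_nonneg _) |>.1 h'
      have : x = y := sub_eq_zero.1 (norm_eq_zero.1 h''.1)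
      rw [← this, hx2]
  exact Subtype.ext key

theorem core : NormedSpace.Core ℝ (SpaceX Ω s p) where
  norm_nonneg u := by
    rw [norm_def]
    positivity
  norm_smul c u := by
    have h0 : 0 < p := by linarith [hp.out]
    have hQ := Real.rpow_nonneg u.nQ_nonneg p
    have hΩ := Real.rpow_nonneg u.nΩ_nonneg p
    rw [norm_eq, norm_eq, nQ_smul, nΩ_smul, Real.mul_rpow (abs_nonneg c) u.nQ_nonneg,
      Real.mul_rpow (abs_nonneg c) u.nΩ_nonneg, ← mul_add,
      Real.mul_rpow (by positivity) (by positivity), ← Real.rpow_mul (abs_nonneg c),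
      mul_one_div_cancel h0.ne', Real.rpow_one, Real.norm_eq_abs]
  norm_triangle u v := by
    have h0 : 0 < p := by linarith [hp.out]
    have hQ := (u + v).nQ_nonneg
    have hΩ := (u + v).nΩ_nonneg
    have h := Real.Lp_add_le_of_nonneg (s := Finset.univ) (f := ![u.nQ, u.nΩ])
      (g := ![v.nQ, v.nΩ]) hp.out.le
      (by intro i _; fin_cases i <;> simp [nQ_nonneg, nΩ_nonneg])
      (by intro i _; fin_cases i <;> simp [nQ_nonneg, nΩ_nonneg])
    simp only [Fin.sum_univ_two, Matrix.cons_val_zero, Matrix.cons_val_one] at h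
    rw [norm_eq, norm_eq, norm_eq]
    refine le_trans ?_ h
    have a1 := nQ_add_le u v
    have a2 := nΩ_add_le u v
    gcongr
  norm_eq_zero_iff u := by
    refine ⟨eq_zero_of_norm_eq_zero u, ?_⟩
    rintro rfl
    have h0 : 0 < p := by linarith [hp.out]
    have e1 := nQ_smul 0 (0 : SpaceX Ω s p)
    have e2 := nΩ_smul 0 (0 : SpaceX Ω s p)
    rw [zero_smul, abs_zero, zero_mul] at e1 e2
    rw [norm_eq, e1, e2, Real.zero_rpow h0.ne', add_zero, Real.zero_rpow (by positivity)]

noncomputable instance : NormedAddCommGroup (SpaceX Ω s p) :=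
  NormedAddCommGroup.ofCore core

noncomputable instance : NormedSpace ℝ (SpaceX Ω s p) :=
  NormedSpace.ofCore core

/-- The functional `A(u) = [u]^p`. -/
noncomputable def A (u : SpaceX Ω s p) : ℝ := u.gagliardoSeminorm ^ p

end SpaceX

/-- The `(S)₊` property of a map `F : E → E'` from a real normed space to its dual. -/
def HasSPlus {E : Type*} [NormedAddCommGroup E] [NormedSpace ℝ E]
    (F : E → StrongDual ℝ E) : Prop :=
  ∀ (v : ℕ → E) (u : E),
    (∀ φ : StrongDual ℝ E, Tendsto (fun n => φ (v n)) atTop (𝓝 (φ u))) →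
    limsup (fun n => ((F (v n) (v n - u) : ℝ) : EReal)) atTop ≤ 0 →
    Tendsto v atTop (𝓝 u)

end NeumannFrac

/-!
The weighted difference quotient `quot` gives a continuous linear map `quotL` from `X` to `L^p(𝒬)`
with `A u = ‖quotL u‖ ^ p`. Hence both assertions about `A` are mostly assertions about the
functional `‖·‖ ^ p` on an abstract space `L^p(μ)`, `1 < p < ∞`, whose derivative at `f` is
`h ↦ p ∫ |f| ^ (p - 2) f h` (`normRpowDeriv`).

*Differentiability* (`hasFDerivAt_norm_rpow_Lp`). The scalar function `|·| ^ p` satisfies a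
first-order Taylor estimate with remainder at most `ε |a| ^ (p - 1) |b| + C_ε |b| ^ p`
(`abs_rpow_taylor`). Integrating it and using Hölder's inequality bounds the remainder on `L^p` by
`ε M ‖h‖ + C_ε ‖h‖ ^ p`, which is `o(‖h‖)`.

*The `(S)₊` property.* By homogeneity and compactness,
`|a - b| ^ p ≤ ε (|a| ^ p + |b| ^ p) + C_ε (|a| ^ (p - 2) a - |b| ^ (p - 2) b) (a - b)`
(`abs_sub_rpow_le`); this treats `p < 2` and `p ≥ 2` at once. Integrated, it shows that a bounded
sequence in `L^p` for which the monotonicity gap of the derivative tends to `0` converges in norm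
(`tendsto_of_limsup_normRpowDeriv_le`). If `u_n ⇀ u` in `X`, the sequence is bounded and
`⟨A'(u), u_n - u⟩ → 0`, so the hypothesis on the upper limit makes the gap tend to `0`, and
`[u_n - u] → 0`. The `L^p(Ω)` part of the norm follows from the Poincaré inequality
`exists_nΩ_le`, since `∫_Ω (u_n - u) → 0` by weak convergence.
-/

namespace NeumannFrac

/-! ### Scalar estimates for `|t| ^ p` -/

theorem abs_rpow_taylor_one {p : ℝ} (hp : 1 < p) {ε : ℝ} (hε : 0 < ε) :
    ∃ C : ℝ, 1 ≤ C ∧ ∀ t : ℝ,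
      |(|1 + t| ^ p - 1 - p * t)| ≤ ε * |t| + C * |t| ^ p := by
  have hd := (hasDerivAt_iff_isLittleO_nhds_zero.1 (hasDerivAt_abs_rpow 1 hp)).def hε
  obtain ⟨δ, hδ, hball⟩ := Metric.eventually_nhds_iff.1 hd
  have h0 : 0 < p := by linarith
  refine ⟨(2 + p) * (1 / δ + 1) ^ p, ?_, fun t => ?_⟩
  · have : 1 ≤ (1 / δ + 1) ^ p := Real.one_le_rpow (by linarith [one_div_pos.2 hδ]) h0.le
    nlinarith
  · rcases lt_or_ge |t| δ with ht | ht
    · have h1 := hball (y := t) (by simpa using ht)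
      simp only [Real.norm_eq_abs, abs_one, Real.one_rpow, smul_eq_mul, mul_one] at h1
      rw [mul_comm t p] at h1
      have h2 : 0 ≤ (2 + p) * (1 / δ + 1) ^ p * |t| ^ p := by positivity
      linarith
    · have e1 : 1 + |t| ≤ (1 / δ + 1) * |t| := by
        have : 1 ≤ 1 / δ * |t| := by rw [one_div, inv_mul_eq_div]; exact (one_le_div hδ).2 ht
        linarith
      have e2 : (1 + |t|) ^ p ≤ (1 / δ + 1) ^ p * |t| ^ p := by
        rw [← Real.mul_rpow (by positivity) (abs_nonneg t)]
        exact Real.rpow_le_rpow (by positivity) e1 h0.le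
      have e3 : |1 + t| ^ p ≤ (1 + |t|) ^ p :=
        Real.rpow_le_rpow (abs_nonneg _) (by simpa using abs_add_le 1 t) h0.le
      have e4 : 1 + |t| ≤ (1 + |t|) ^ p :=
        Real.self_le_rpow_of_one_le (by linarith [abs_nonneg t]) hp.le
      have e5 : |(|1 + t| ^ p - 1 - p * t)| ≤ |1 + t| ^ p + 1 + p * |t| := by
        have a1 : 0 ≤ |1 + t| ^ p := by positivity
        rw [abs_le]
        constructor <;> nlinarith [neg_abs_le t, le_abs_self t]
      have e6 : p * |t| ≤ p * (1 + |t|) ^ p := by gcongr; linarith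
      have e7 : 0 ≤ ε * |t| := by positivity
      have e8 : (2 + p) * (1 + |t|) ^ p ≤ (2 + p) * ((1 / δ + 1) ^ p * |t| ^ p) := by gcongr
      linarith [abs_nonneg t]

/-- First-order Taylor estimate for `|·| ^ p`, uniform in the base point: by homogeneity it
reduces to the base point `1`, where it combines differentiability near `0` with growth of order
`p` at infinity. -/
theorem abs_rpow_taylor {p : ℝ} (hp : 1 < p) {ε : ℝ} (hε : 0 < ε) :
    ∃ C : ℝ, 0 ≤ C ∧ ∀ a b : ℝ,
      |(|a + b| ^ p - |a| ^ p - p * (|a| ^ (p - 2) * a) * b)|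
        ≤ ε * (|a| ^ (p - 1) * |b|) + C * |b| ^ p := by
  obtain ⟨C, hC, h⟩ := abs_rpow_taylor_one hp hε
  refine ⟨C, by linarith, fun a b => ?_⟩
  rcases eq_or_ne a 0 with rfl | ha
  · have hb : 0 ≤ |b| ^ p := by positivity
    rw [abs_zero, Real.zero_rpow (show p ≠ 0 by linarith),
      Real.zero_rpow (show p - 1 ≠ 0 by linarith)]
    simp only [zero_add, sub_zero, mul_zero, zero_mul]
    rw [abs_of_nonneg hb]
    nlinarith
  · have ha' : 0 < |a| := abs_pos.2 ha
    obtain ⟨t, rfl⟩ : ∃ t, b = a * t := ⟨b / a, by field_simp⟩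
    have e1 : |a + a * t| ^ p = |a| ^ p * |1 + t| ^ p := by
      rw [← Real.mul_rpow (abs_nonneg _) (abs_nonneg _), ← abs_mul]; ring_nf
    have e2 : |a| ^ (p - 2) * a * a = |a| ^ p := by
      have : |a| ^ p = |a| ^ (p - 2) * |a| ^ (2 : ℝ) := by
        rw [← Real.rpow_add ha']; ring_nf
      rw [this, Real.rpow_two, sq_abs]; ring
    have e3 : |a| ^ (p - 1) * |a| = |a| ^ p := by
      have : |a| ^ p = |a| ^ (p - 1) * |a| ^ (1 : ℝ) := by
        rw [← Real.rpow_add ha']; ring_nf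
      rw [this, Real.rpow_one]
    have e4 : |a + a * t| ^ p - |a| ^ p - p * (|a| ^ (p - 2) * a) * (a * t)
        = |a| ^ p * (|1 + t| ^ p - 1 - p * t) := by
      rw [e1, ← e2]
      ring
    rw [e4, abs_mul, abs_of_nonneg (by positivity : 0 ≤ |a| ^ p), abs_mul,
      Real.mul_rpow (abs_nonneg a) (abs_nonneg t)]
    calc |a| ^ p * |(|1 + t| ^ p - 1 - p * t)| ≤ |a| ^ p * (ε * |t| + C * |t| ^ p) := by
          gcongr; exact h t
      _ = _ := by rw [← mul_assoc (|a| ^ (p - 1)), e3]; ring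

theorem strictMono_abs_rpow_mul {p : ℝ} (hp : 1 < p) :
    StrictMono fun t : ℝ => |t| ^ (p - 2) * t := by
  refine strictMono_of_odd_strictMonoOn_nonneg (fun t => by simp) ?_
  have key : ∀ t : ℝ, 0 ≤ t → |t| ^ (p - 2) * t = t ^ (p - 1) := by
    intro t ht
    rcases ht.eq_or_lt with rfl | ht
    · rw [mul_zero, Real.zero_rpow (by linarith)]
    · rw [abs_of_pos ht, show p - 1 = (p - 2) + 1 by ring, Real.rpow_add ht, Real.rpow_one]
  intro x hx y hy hxy
  simp only [key x hx, key y hy]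
  exact Real.rpow_lt_rpow hx hxy (by linarith)

theorem abs_abs_rpow_mul {p : ℝ} (hp : 1 < p) (t : ℝ) :
    |(|t| ^ (p - 2) * t)| = |t| ^ (p - 1) := by
  rcases eq_or_ne t 0 with rfl | ht
  · simp [Real.zero_rpow (show p - 1 ≠ 0 by linarith)]
  · rw [abs_mul, abs_of_nonneg (by positivity), show p - 1 = (p - 2) + 1 by ring,
      Real.rpow_add (abs_pos.2 ht), Real.rpow_one]

theorem continuous_abs_rpow_mul {p : ℝ} (hp : 1 < p) :
    Continuous fun t : ℝ => |t| ^ (p - 2) * t := by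
  rw [continuous_iff_continuousAt]
  intro t
  rcases eq_or_ne t 0 with rfl | ht
  · have h : Tendsto (fun t : ℝ => |t| ^ (p - 1)) (𝓝 0) (𝓝 0) := by
      have : ContinuousAt (fun t : ℝ => |t| ^ (p - 1)) 0 :=
        (continuous_abs.continuousAt).rpow_const (Or.inr (by linarith))
      simpa [ContinuousAt, Real.zero_rpow (show p - 1 ≠ 0 by linarith)] using this
    unfold ContinuousAt
    simp only [mul_zero]
    refine squeeze_zero_norm (fun t => ?_) h
    rw [Real.norm_eq_abs, abs_abs_rpow_mul hp]
  · exact (continuous_abs.continuousAt.rpow_const (Or.inl (abs_pos.2 ht).ne')).mul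
      continuousAt_id

theorem monotone_gap_nonneg {p : ℝ} (hp : 1 < p) (a b : ℝ) :
    0 ≤ (|a| ^ (p - 2) * a - |b| ^ (p - 2) * b) * (a - b) := by
  have hm := (strictMono_abs_rpow_mul hp).monotone
  rcases le_total a b with h | h
  · exact mul_nonneg_of_nonpos_of_nonpos (sub_nonpos.2 (hm h)) (sub_nonpos.2 h)
  · exact mul_nonneg (sub_nonneg.2 (hm h)) (sub_nonneg.2 h)

/-- Quantitative strict monotonicity of `t ↦ |t| ^ (p - 2) * t`, valid for `p < 2` and `p ≥ 2`
alike: both sides are homogeneous of degree `p`, and on the compact set `max |a| |b| = 1`,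
`|a - b| ^ p ≥ ε` the monotonicity gap has a positive minimum. -/
theorem abs_sub_rpow_le {p : ℝ} (hp : 1 < p) {ε : ℝ} (hε : 0 < ε) :
    ∃ C : ℝ, 0 ≤ C ∧ ∀ a b : ℝ,
      |a - b| ^ p ≤ ε * (|a| ^ p + |b| ^ p)
        + C * ((|a| ^ (p - 2) * a - |b| ^ (p - 2) * b) * (a - b)) := by
  have h0 : 0 < p := by linarith
  have hφ := continuous_abs_rpow_mul hp
  set G : ℝ × ℝ → ℝ := fun z =>
    (|z.1| ^ (p - 2) * z.1 - |z.2| ^ (p - 2) * z.2) * (z.1 - z.2) with hG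
  have hGc : Continuous G :=
    ((hφ.comp continuous_fst).sub (hφ.comp continuous_snd)).mul
      (continuous_fst.sub continuous_snd)
  set S : Set (ℝ × ℝ) := Metric.sphere 0 1 ∩ {z | ε ≤ |z.1 - z.2| ^ p} with hS
  have hScomp : IsCompact S := by
    refine (isCompact_sphere 0 1).inter_right (isClosed_le continuous_const ?_)
    exact (continuous_abs.comp (continuous_fst.sub continuous_snd)).rpow_const
      fun _ => Or.inr h0.le
  have hGpos : ∀ z ∈ S, 0 < G z := by
    rintro ⟨a, b⟩ ⟨-, hz⟩
    refine lt_of_le_of_ne (monotone_gap_nonneg hp a b) fun h => ?_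
    have hab : a = b := by
      rcases mul_eq_zero.1 h.symm with h | h
      · exact (strictMono_abs_rpow_mul hp).injective (sub_eq_zero.1 h)
      · exact sub_eq_zero.1 h
    subst hab
    simp only [mem_ofPred_eq, sub_self, abs_zero, Real.zero_rpow h0.ne'] at hz
    linarith
  obtain ⟨m, hm, hmG⟩ : ∃ m : ℝ, 0 < m ∧ ∀ z ∈ S, m ≤ G z := by
    rcases S.eq_empty_or_nonempty with h | h
    · exact ⟨1, one_pos, by simp [h]⟩
    · obtain ⟨z, hz, hmin⟩ := hScomp.exists_isMinOn h hGc.continuousOn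
      exact ⟨G z, hGpos z hz, fun w hw => hmin hw⟩
  -- the estimate on the unit sphere
  have sph : ∀ a b : ℝ, max |a| |b| = 1 → |a - b| ^ p ≤ ε * (|a| ^ p + |b| ^ p)
      + 2 ^ p / m * G (a, b) := by
    intro a b hab
    have hg : 0 ≤ G (a, b) := monotone_gap_nonneg hp a b
    have hsum : 1 ≤ |a| ^ p + |b| ^ p := by
      have h1 : 0 ≤ |a| ^ p := by positivity
      have h2 : 0 ≤ |b| ^ p := by positivity
      rcases max_choice |a| |b| with h | h <;> rw [h] at hab <;> rw [hab, Real.one_rpow] <;>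
        linarith
    rcases lt_or_ge (|a - b| ^ p) ε with h | h
    · have : 0 ≤ 2 ^ p / m * G (a, b) := by positivity
      nlinarith
    · have hmem : (a, b) ∈ S := ⟨by simpa [Prod.norm_def] using hab, h⟩
      have h2 : |a - b| ^ p ≤ 2 ^ p := by
        refine Real.rpow_le_rpow (abs_nonneg _) ?_ h0.le
        have := abs_sub a b
        linarith [le_max_left |a| |b|, le_max_right |a| |b|]
      have h3 : (2 : ℝ) ^ p ≤ 2 ^ p / m * G (a, b) := by
        rw [div_mul_eq_mul_div, le_div_iff₀ hm]
        have := hmG _ hmem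
        gcongr
      have : 0 ≤ ε * (|a| ^ p + |b| ^ p) := by positivity
      linarith
  refine ⟨2 ^ p / m, by positivity, fun a b => ?_⟩
  change _ ≤ _ + _ * G (a, b)
  rcases eq_or_ne (max |a| |b|) 0 with h | h
  · have ha : a = 0 := abs_eq_zero.1
      (le_antisymm (h ▸ le_max_left _ _) (abs_nonneg a))
    have hb : b = 0 := abs_eq_zero.1
      (le_antisymm (h ▸ le_max_right _ _) (abs_nonneg b))
    subst ha hb
    simp [G, Real.zero_rpow h0.ne']
  · set r := max |a| |b| with hr
    have hrpos : 0 < r := lt_of_le_of_ne (le_trans (abs_nonneg a) (le_max_left _ _)) h.symm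
    have hscale : ∀ c : ℝ, |r * c| ^ p = r ^ p * |c| ^ p := fun c => by
      rw [abs_mul, abs_of_pos hrpos, Real.mul_rpow hrpos.le (abs_nonneg _)]
    have hscale' : ∀ c : ℝ, |r * c| ^ (p - 2) * (r * c)
        = r ^ (p - 2) * r * (|c| ^ (p - 2) * c) := fun c => by
      rw [abs_mul, abs_of_pos hrpos, Real.mul_rpow hrpos.le (abs_nonneg _)]
      ring
    have hrp : r ^ p = r ^ (p - 2) * r * r := by
      have : r ^ p = r ^ (p - 2) * r ^ (2 : ℝ) := by rw [← Real.rpow_add hrpos]; ring_nf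
      rw [this, Real.rpow_two]; ring
    obtain ⟨x, hx⟩ : ∃ x, a = r * x := ⟨a / r, by field_simp⟩
    obtain ⟨y, hy⟩ : ∃ y, b = r * y := ⟨b / r, by field_simp⟩
    have hxy : max |x| |y| = 1 := by
      have h1 : r = r * max |x| |y| := by
        conv_lhs => rw [hr, hx, hy, abs_mul, abs_mul, abs_of_pos hrpos,
          ← mul_max_of_nonneg _ _ hrpos.le]
      exact mul_left_cancel₀ hrpos.ne' (by linarith)
    have key := mul_le_mul_of_nonneg_left (sph x y hxy) (Real.rpow_nonneg hrpos.le p)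
    have hGs : G (a, b) = r ^ p * G (x, y) := by
      simp only [G, hx, hy, hscale', hrp]
      ring
    rw [hGs, hx, hy, hscale, hscale, ← mul_sub, hscale]
    linarith

/-! ### The functional `‖·‖ ^ p` on `L^p` -/

instance fact_one_le_ofReal {p : ℝ} [hp : Fact (1 < p)] : Fact (1 ≤ ENNReal.ofReal p) :=
  ⟨by simpa using hp.out.le⟩

instance holderConjugate_ofReal {p : ℝ} [hp : Fact (1 < p)] :
    ENNReal.HolderConjugate (ENNReal.ofReal (p / (p - 1))) (ENNReal.ofReal p) :=
  (Real.HolderConjugate.conjExponent hp.out).symm.ennrealOfReal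

instance fact_one_le_ofReal_conj {p : ℝ} [hp : Fact (1 < p)] :
    Fact (1 ≤ ENNReal.ofReal (p / (p - 1))) :=
  ⟨by
    rw [← ENNReal.ofReal_one]
    have : 0 < p - 1 := sub_pos.2 hp.out
    exact ENNReal.ofReal_le_ofReal ((one_le_div this).2 (by linarith))⟩

section Lp

variable {α : Type*} [MeasurableSpace α] {μ : Measure α} {p : ℝ} [hp : Fact (1 < p)]

theorem norm_rpow_eq_integral (f : Lp ℝ (ENNReal.ofReal p) μ) : ‖f‖ ^ p = ∫ a, |f a| ^ p ∂μ := by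
  have h0 : 0 < p := by linarith [hp.out]
  have hi : 0 ≤ ∫ a, |f a| ^ p ∂μ := integral_nonneg fun a => by positivity
  rw [Lp.norm_def, (Lp.memLp f).eLpNorm_eq_integral_rpow_norm (by simpa using h0)
    ENNReal.ofReal_ne_top, ENNReal.toReal_ofReal h0.le]
  simp only [Real.norm_eq_abs]
  rw [ENNReal.toReal_ofReal (by positivity), ← Real.rpow_mul hi, inv_mul_cancel₀ h0.ne',
    Real.rpow_one]

theorem integrable_abs_rpow (f : Lp ℝ (ENNReal.ofReal p) μ) :
    Integrable (fun a => |f a| ^ p) μ := by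
  have h0 : 0 < p := by linarith [hp.out]
  have := (Lp.memLp f).integrable_norm_rpow (by simpa using h0) ENNReal.ofReal_ne_top
  simpa [ENNReal.toReal_ofReal h0.le] using this

theorem memLp_abs_rpow_mul (f : Lp ℝ (ENNReal.ofReal p) μ) :
    MemLp (fun a => |f a| ^ (p - 2) * f a) (ENNReal.ofReal (p / (p - 1))) μ := by
  have h1 : 0 < p - 1 := sub_pos.2 hp.out
  have h := (Lp.memLp f).norm_rpow_div (ENNReal.ofReal (p - 1))
  rw [← ENNReal.ofReal_div_of_pos h1, ENNReal.toReal_ofReal h1.le] at h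
  refine h.of_le ((continuous_abs_rpow_mul hp.out).comp_aestronglyMeasurable
    (Lp.aestronglyMeasurable f)) (ae_of_all _ fun a => ?_)
  rw [Real.norm_eq_abs, abs_abs_rpow_mul hp.out, Real.norm_eq_abs, Real.norm_eq_abs]
  exact le_abs_self _

/-- The element `|f| ^ (p - 2) f` of the conjugate Lebesgue space attached to `f ∈ L^p`. -/
noncomputable def conjElement (f : Lp ℝ (ENNReal.ofReal p) μ) :
    Lp ℝ (ENNReal.ofReal (p / (p - 1))) μ :=
  (memLp_abs_rpow_mul f).toLp _

theorem coeFn_conjElement (f : Lp ℝ (ENNReal.ofReal p) μ) :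
    conjElement f =ᵐ[μ] fun a => |f a| ^ (p - 2) * f a :=
  MemLp.coeFn_toLp _

theorem integrable_abs_rpow_mul_mul (f h : Lp ℝ (ENNReal.ofReal p) μ) :
    Integrable (fun a => |f a| ^ (p - 2) * f a * h a) μ :=
  (memLp_abs_rpow_mul f).integrable_mul (Lp.memLp h)

/-- The functional `h ↦ p ∫ |f| ^ (p - 2) f h` on `L^p`, which is the derivative of `‖·‖ ^ p`
at `f`. -/
noncomputable def normRpowDeriv (f : Lp ℝ (ENNReal.ofReal p) μ) :
    StrongDual ℝ (Lp ℝ (ENNReal.ofReal p) μ) :=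
  p • (ContinuousLinearMap.mul ℝ ℝ).lpPairing μ (ENNReal.ofReal (p / (p - 1)))
    (ENNReal.ofReal p) (conjElement f)

theorem normRpowDeriv_apply (f h : Lp ℝ (ENNReal.ofReal p) μ) :
    normRpowDeriv f h = p * ∫ a, |f a| ^ (p - 2) * f a * h a ∂μ := by
  rw [normRpowDeriv, smul_apply, ContinuousLinearMap.lpPairing_eq_integral,
    smul_eq_mul]
  congr 1
  refine integral_congr_ae ?_
  filter_upwards [coeFn_conjElement f] with a ha
  simp [ha]

theorem exists_integral_abs_rpow_mul_le (f : Lp ℝ (ENNReal.ofReal p) μ) :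
    ∃ M : ℝ, 0 ≤ M ∧ ∀ h : Lp ℝ (ENNReal.ofReal p) μ,
      Integrable (fun a => |f a| ^ (p - 1) * |h a|) μ ∧
      ∫ a, |f a| ^ (p - 1) * |h a| ∂μ ≤ M * ‖h‖ := by
  refine ⟨‖ContinuousLinearMap.mul ℝ ℝ‖ * ‖conjElement f‖, by positivity, fun h => ?_⟩
  have e : ∀ a, |f a| ^ (p - 1) * |h a| = ‖|f a| ^ (p - 2) * f a * h a‖ := fun a => by
    rw [Real.norm_eq_abs, abs_mul _ (h a), abs_abs_rpow_mul hp.out]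
  simp only [e]
  refine ⟨(integrable_abs_rpow_mul_mul f h).norm, ?_⟩
  refine le_trans (le_of_eq ?_) (ContinuousLinearMap.norm_holder_apply_apply_le
    (r := 1) (ContinuousLinearMap.mul ℝ ℝ) (conjElement f) h)
  rw [L1.norm_eq_integral_norm]
  refine integral_congr_ae ?_
  filter_upwards [coeFn_conjElement f, ContinuousLinearMap.coeFn_holder (r := 1)
    (ContinuousLinearMap.mul ℝ ℝ) (conjElement f) h] with a ha hb
  rw [hb, ContinuousLinearMap.mul_apply', ha]

/-- On `L^p` with `1 < p < ∞` the map `‖·‖ ^ p` is Fréchet differentiable. -/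
theorem hasFDerivAt_norm_rpow_Lp (f : Lp ℝ (ENNReal.ofReal p) μ) :
    HasFDerivAt (fun f : Lp ℝ (ENNReal.ofReal p) μ => ‖f‖ ^ p) (normRpowDeriv f) f := by
  have hp1 := hp.out
  rw [hasFDerivAt_iff_isLittleO_nhds_zero, Asymptotics.isLittleO_iff]
  intro c hc
  obtain ⟨M, hM, hMh⟩ := exists_integral_abs_rpow_mul_le f
  obtain ⟨C, hC, hT⟩ := abs_rpow_taylor hp1 (ε := c / (2 * (M + 1))) (by positivity)
  have bound : ∀ h : Lp ℝ (ENNReal.ofReal p) μ,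
      ‖‖f + h‖ ^ p - ‖f‖ ^ p - normRpowDeriv f h‖
        ≤ c / (2 * (M + 1)) * (M * ‖h‖) + C * ‖h‖ ^ p := by
    intro h
    obtain ⟨hi, hle⟩ := hMh h
    have i1 := integrable_abs_rpow f
    have i2 := integrable_abs_rpow (f + h)
    have i3 := integrable_abs_rpow h
    have i4 := (integrable_abs_rpow_mul_mul f h).const_mul p
    have i5 : Integrable (fun a => |(f + h) a| ^ p - |f a| ^ p) μ := i2.sub i1
    have e : ‖f + h‖ ^ p - ‖f‖ ^ p - normRpowDeriv f h
        = ∫ a, (|(f + h) a| ^ p - |f a| ^ p - p * (|f a| ^ (p - 2) * f a * h a)) ∂μ := by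
      rw [norm_rpow_eq_integral, norm_rpow_eq_integral, normRpowDeriv_apply,
        integral_sub i5 i4, integral_sub i2 i1, integral_const_mul]
    rw [e, norm_rpow_eq_integral h]
    calc _ ≤ ∫ a, ‖|(f + h) a| ^ p - |f a| ^ p - p * (|f a| ^ (p - 2) * f a * h a)‖ ∂μ :=
          norm_integral_le_integral_norm _
      _ ≤ ∫ a, (c / (2 * (M + 1)) * (|f a| ^ (p - 1) * |h a|) + C * |h a| ^ p) ∂μ := by
          refine integral_mono_ae (i5.sub i4).norm
            ((hi.const_mul _).add (i3.const_mul _)) ?_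
          filter_upwards [Lp.coeFn_add f h] with a ha
          rw [ha, Pi.add_apply, Real.norm_eq_abs, ← mul_assoc p]
          exact hT (f a) (h a)
      _ = c / (2 * (M + 1)) * ∫ a, |f a| ^ (p - 1) * |h a| ∂μ + C * ∫ a, |h a| ^ p ∂μ := by
          rw [integral_add (hi.const_mul _) (i3.const_mul _), integral_const_mul,
            integral_const_mul]
      _ ≤ _ := by gcongr
  have hlim : Tendsto (fun h : Lp ℝ (ENNReal.ofReal p) μ => C * ‖h‖ ^ (p - 1)) (𝓝 0) (𝓝 0) := by
    have : ContinuousAt (fun h : Lp ℝ (ENNReal.ofReal p) μ => C * ‖h‖ ^ (p - 1)) 0 :=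
      continuousAt_const.mul (continuous_norm.continuousAt.rpow_const (Or.inr (by linarith)))
    simpa [ContinuousAt, Real.zero_rpow (show p - 1 ≠ 0 by linarith)] using this
  filter_upwards [hlim.eventually_lt_const (half_pos hc)] with h hh
  refine (bound h).trans ?_
  have e1 : c / (2 * (M + 1)) * (M * ‖h‖) ≤ c / 2 * ‖h‖ := by
    rw [← mul_assoc]
    refine mul_le_mul_of_nonneg_right ?_ (norm_nonneg h)
    rw [div_mul_eq_mul_div, div_le_div_iff₀ (by positivity) (by positivity)]
    nlinarith
  have e2 : C * ‖h‖ ^ p ≤ c / 2 * ‖h‖ := by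
    rcases (norm_nonneg h).eq_or_lt with h0 | h0
    · rw [← h0, Real.zero_rpow (by linarith)]
      simp
    · rw [show ‖h‖ ^ p = ‖h‖ ^ (p - 1) * ‖h‖ by
        rw [← Real.rpow_add_one h0.ne', sub_add_cancel], ← mul_assoc]
      gcongr
  linarith

theorem integral_monotone_gap_eq (f g : Lp ℝ (ENNReal.ofReal p) μ) :
    Integrable (fun a => (|f a| ^ (p - 2) * f a - |g a| ^ (p - 2) * g a) * (f a - g a)) μ ∧
    (normRpowDeriv f - normRpowDeriv g) (f - g)
      = p * ∫ a, (|f a| ^ (p - 2) * f a - |g a| ^ (p - 2) * g a) * (f a - g a) ∂μ := by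
  have j1 := integrable_abs_rpow_mul_mul f (f - g)
  have j2 := integrable_abs_rpow_mul_mul g (f - g)
  have e : (fun a => |f a| ^ (p - 2) * f a * (f - g : Lp ℝ (ENNReal.ofReal p) μ) a
        - |g a| ^ (p - 2) * g a * (f - g : Lp ℝ (ENNReal.ofReal p) μ) a)
      =ᵐ[μ] fun a => (|f a| ^ (p - 2) * f a - |g a| ^ (p - 2) * g a) * (f a - g a) := by
    filter_upwards [Lp.coeFn_sub f g] with a ha
    rw [ha, Pi.sub_apply]
    ring
  refine ⟨(j1.sub j2).congr e, ?_⟩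
  rw [sub_apply, normRpowDeriv_apply, normRpowDeriv_apply, ← mul_sub,
    ← integral_sub j1 j2, integral_congr_ae e]

/-- Quantitative monotonicity of the derivative of `‖·‖ ^ p` on `L^p`, up to an error
that is an arbitrarily small multiple of `‖f‖ ^ p + ‖g‖ ^ p`. -/
theorem norm_sub_rpow_le (p : ℝ) [hp : Fact (1 < p)] {ε : ℝ} (hε : 0 < ε) :
    ∃ C : ℝ, 0 ≤ C ∧ ∀ f g : Lp ℝ (ENNReal.ofReal p) μ,
      ‖f - g‖ ^ p ≤ ε * (‖f‖ ^ p + ‖g‖ ^ p)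
        + C * (normRpowDeriv f - normRpowDeriv g) (f - g) := by
  have h0 : 0 < p := by linarith [hp.out]
  obtain ⟨C, hC, h⟩ := abs_sub_rpow_le hp.out hε
  refine ⟨C / p, by positivity, fun f g => ?_⟩
  obtain ⟨hi, e⟩ := integral_monotone_gap_eq f g
  have i1 := integrable_abs_rpow f
  have i2 := integrable_abs_rpow g
  have i3 : Integrable (fun a => |f a| ^ p + |g a| ^ p) μ := i1.add i2
  rw [e, ← mul_assoc, div_mul_cancel₀ _ h0.ne', norm_rpow_eq_integral, norm_rpow_eq_integral,
    norm_rpow_eq_integral, ← integral_add i1 i2, ← integral_const_mul, ← integral_const_mul,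
    ← integral_add (i3.const_mul _) (hi.const_mul _)]
  refine integral_mono_ae (integrable_abs_rpow (f - g))
    ((i3.const_mul _).add (hi.const_mul _)) ?_
  filter_upwards [Lp.coeFn_sub f g] with a ha
  rw [ha, Pi.sub_apply]
  exact h (f a) (g a)

/-- The `(S)₊` property of the derivative of `‖·‖ ^ p` on `L^p`, with weak convergence replaced
by boundedness and by convergence against the single functional `normRpowDeriv f`. -/
theorem tendsto_of_limsup_normRpowDeriv_le {v : ℕ → Lp ℝ (ENNReal.ofReal p) μ}
    {f : Lp ℝ (ENNReal.ofReal p) μ} {K : ℝ} (hK : ∀ n, ‖v n‖ ≤ K)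
    (hw : Tendsto (fun n => normRpowDeriv f (v n - f)) atTop (𝓝 0))
    (hl : limsup (fun n => ((normRpowDeriv (v n) (v n - f) : ℝ) : EReal)) atTop ≤ 0) :
    Tendsto v atTop (𝓝 f) := by
  have h0 : 0 < p := by linarith [hp.out]
  rw [Metric.tendsto_atTop']
  intro η hη
  have hK0 : 0 ≤ K := (norm_nonneg _).trans (hK 0)
  have hηp : 0 < η ^ p := Real.rpow_pos_of_pos hη p
  set B := K ^ p + ‖f‖ ^ p with hB
  have hB0 : 0 ≤ B := by positivity
  obtain ⟨C, hC, h⟩ := norm_sub_rpow_le (μ := μ) p (ε := η ^ p / (2 * (B + 1))) (by positivity)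
  set d := η ^ p / (4 * (C + 1)) with hd
  have hd0 : 0 < d := by positivity
  have h1 : ∀ᶠ n in atTop, normRpowDeriv (v n) (v n - f) < d := by
    have := eventually_lt_of_limsup_lt (hl.trans_lt (EReal.coe_pos.2 hd0))
    exact this.mono fun n hn => EReal.coe_lt_coe_iff.1 hn
  have h2 := hw.eventually_const_lt (neg_lt_zero.2 hd0)
  refine eventually_atTop.1 ?_ |>.imp fun n hn m hm => hn m (le_of_lt hm)
  filter_upwards [h1, h2] with n a1 a2
  rw [dist_eq_norm]
  refine (Real.rpow_lt_rpow_iff (norm_nonneg _) hη.le h0).1 ((h (v n) f).trans_lt ?_)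
  rw [sub_apply]
  have b1 : ‖v n‖ ^ p + ‖f‖ ^ p ≤ B := by
    have := Real.rpow_le_rpow (norm_nonneg _) (hK n) h0.le
    linarith
  have b2 : η ^ p / (2 * (B + 1)) * (‖v n‖ ^ p + ‖f‖ ^ p) < η ^ p / 2 := by
    calc _ ≤ η ^ p / (2 * (B + 1)) * B := by gcongr
      _ < η ^ p / 2 := by
        rw [div_mul_eq_mul_div, div_lt_div_iff₀ (by positivity) (by positivity)]
        nlinarith
  have b3 : C * (normRpowDeriv (v n) (v n - f) - normRpowDeriv f (v n - f)) ≤ η ^ p / 2 := by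
    calc _ ≤ C * (2 * d) := by gcongr; linarith
      _ ≤ η ^ p / 2 := by
        rw [hd, ← mul_div_assoc, ← mul_div_assoc,
          div_le_div_iff₀ (by positivity) (by positivity)]
        nlinarith
  linarith

end Lp

/-- Weakly convergent sequences are bounded. -/
theorem exists_norm_le_of_tendsto_weak {E : Type*} [NormedAddCommGroup E] [NormedSpace ℝ E]
    {v : ℕ → E} {u : E}
    (h : ∀ φ : StrongDual ℝ E, Tendsto (fun n => φ (v n)) atTop (𝓝 (φ u))) :
    ∃ K : ℝ, ∀ n, ‖v n‖ ≤ K := by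
  obtain ⟨K, hK⟩ := banach_steinhaus (𝕜 := ℝ)
    (g := fun n => NormedSpace.inclusionInDoubleDual ℝ E (v n)) fun φ => by
      obtain ⟨C, hC⟩ := (Metric.isBounded_range_of_tendsto _ (h φ)).exists_norm_le
      exact ⟨C, fun n => hC _ ⟨n, rfl⟩⟩
  exact ⟨K, fun n =>
    (NormedSpace.inclusionInDoubleDualLi ℝ (E := E)).norm_map (v n) ▸ hK n⟩

/-! ### The space `X`: Poincaré inequality and the functional `A` -/

/-- Averaged form of the Poincaré inequality: by Jensen, the deviation of `w` from its mean is
controlled by the differences `w x - w y`. -/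
theorem eLpNorm_sub_integral_le {α : Type*} [MeasurableSpace α] (μ : Measure α)
    [IsFiniteMeasure μ] {p : ℝ} (hp : 1 < p) {w : α → ℝ} (hw : Measurable w)
    (hwi : Integrable w μ) :
    eLpNorm (fun x => μ.real univ * w x - ∫ y, w y ∂μ) (ENNReal.ofReal p) μ
      ≤ μ univ ^ (1 - 1 / p)
        * eLpNorm (fun z : α × α => w z.1 - w z.2) (ENNReal.ofReal p) (μ.prod μ) := by
  have h0 : 0 < p := by linarith
  set c := μ univ ^ (1 - 1 / p) with hc
  have hdiff : Measurable fun z : α × α => w z.1 - w z.2 := by fun_prop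
  have E : ∀ {β : Type _} [MeasurableSpace β] (ν : Measure β) (f : β → ℝ),
      eLpNorm f (ENNReal.ofReal p) ν ^ p = ∫⁻ b, ‖f b‖ₑ ^ p ∂ν := by
    intro β _ ν f
    rw [eLpNorm_eq_lintegral_rpow_enorm_toReal (by simpa using h0) ENNReal.ofReal_ne_top,
      ENNReal.toReal_ofReal h0.le, ← ENNReal.rpow_mul, one_div, inv_mul_cancel₀ h0.ne',
      ENNReal.rpow_one]
  have hpt : ∀ x, ‖μ.real univ * w x - ∫ y, w y ∂μ‖ₑ
      ≤ c * eLpNorm (fun y => w x - w y) (ENNReal.ofReal p) μ := by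
    intro x
    have e : μ.real univ * w x - ∫ y, w y ∂μ = ∫ y, (w x - w y) ∂μ := by
      rw [integral_sub (integrable_const _) hwi, integral_const, smul_eq_mul]
    rw [e, mul_comm]
    refine (enorm_integral_le_lintegral_enorm _).trans ?_
    rw [← eLpNorm_one_eq_lintegral_enorm]
    have := eLpNorm_le_eLpNorm_mul_rpow_measure_univ (μ := μ) (f := fun y => w x - w y)
      (p := 1) (q := ENNReal.ofReal p) (by simpa using hp.le)
      (measurable_const.sub hw).aestronglyMeasurable
    simpa [ENNReal.toReal_ofReal h0.le, hc] using this
  rw [← ENNReal.rpow_le_rpow_iff h0, ENNReal.mul_rpow_of_nonneg _ _ h0.le, E, E]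
  calc ∫⁻ x, ‖μ.real univ * w x - ∫ y, w y ∂μ‖ₑ ^ p ∂μ
      ≤ ∫⁻ x, c ^ p * ∫⁻ y, ‖w x - w y‖ₑ ^ p ∂μ ∂μ := by
        refine lintegral_mono fun x => ?_
        rw [← E, ← ENNReal.mul_rpow_of_nonneg _ _ h0.le]
        exact ENNReal.rpow_le_rpow (hpt x) h0.le
    _ = c ^ p * ∫⁻ z, ‖w z.1 - w z.2‖ₑ ^ p ∂(μ.prod μ) := by
        have hm : Measurable fun z : α × α => ‖w z.1 - w z.2‖ₑ ^ p := by fun_prop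
        rw [lintegral_prod _ hm.aemeasurable, lintegral_const_mul _ hm.lintegral_prod_right']

namespace SpaceX

variable {N : ℕ} {Ω : LipschitzDomain N} {s p : ℝ} [hp : Fact (1 < p)]

theorem nQ_le_norm (u : SpaceX Ω s p) : u.nQ ≤ ‖u‖ := by
  have h0 : 0 < p := by linarith [hp.out]
  have h1 := Real.rpow_nonneg u.nΩ_nonneg p
  have h2 := Real.rpow_nonneg u.nQ_nonneg p
  rw [norm_eq, one_div, Real.le_rpow_inv_iff_of_pos u.nQ_nonneg (by linarith) h0]
  linarith

theorem nΩ_le_norm (u : SpaceX Ω s p) : u.nΩ ≤ ‖u‖ := by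
  have h0 : 0 < p := by linarith [hp.out]
  have h1 := Real.rpow_nonneg u.nΩ_nonneg p
  have h2 := Real.rpow_nonneg u.nQ_nonneg p
  rw [norm_eq, one_div, Real.le_rpow_inv_iff_of_pos u.nΩ_nonneg (by linarith) h0]
  linarith

theorem norm_le_add (u : SpaceX Ω s p) : ‖u‖ ≤ u.nQ + u.nΩ := by
  rw [norm_eq]
  exact Real.rpow_add_rpow_le_add u.nQ_nonneg u.nΩ_nonneg hp.out.le

theorem memLp_quot (u : SpaceX Ω s p) :
    MemLp (quot s p u.toFun) (ENNReal.ofReal p) (volume.restrict (Q Ω)) :=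
  ⟨(quot_measurable s p u.toFun).aestronglyMeasurable, u.finite_Q⟩

theorem memLp_domain (u : SpaceX Ω s p) :
    MemLp u.toFun (ENNReal.ofReal p) (volume.restrict Ω.carrier) :=
  ⟨u.toFun.measurable.aestronglyMeasurable, u.finite_Ω⟩

/-- The weighted difference quotient as a continuous linear map from `X` to `L^p(𝒬)`. -/
noncomputable def quotL :
    SpaceX Ω s p →L[ℝ] Lp ℝ (ENNReal.ofReal p)
      (volume.restrict (Q Ω) : Measure (EuclideanSpace ℝ (Fin N) × EuclideanSpace ℝ (Fin N))) :=
  LinearMap.mkContinuous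
    { toFun := fun u => u.memLp_quot.toLp _
      map_add' := fun u v => by
        rw [← MemLp.toLp_add]
        refine MemLp.toLp_congr _ _ ?_
        rw [← quot_add]
        exact quot_congr s p (AEEqFun.coeFn_add u.toFun v.toFun) (Q Ω)
      map_smul' := fun c u => by
        rw [RingHom.id_apply, ← MemLp.toLp_const_smul]
        refine MemLp.toLp_congr _ _ ?_
        rw [← quot_smul]
        exact quot_congr s p (AEEqFun.coeFn_smul c u.toFun) (Q Ω) }
    1 fun u => by
      rw [one_mul]
      exact (Lp.norm_toLp _ u.memLp_quot).trans_le u.nQ_le_norm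

theorem norm_quotL (u : SpaceX Ω s p) : ‖quotL u‖ = u.nQ :=
  Lp.norm_toLp _ u.memLp_quot

/-- Restriction to `Ω` as a continuous linear map from `X` to `L^p(Ω)`. -/
noncomputable def restrictL :
    SpaceX Ω s p →L[ℝ] Lp ℝ (ENNReal.ofReal p) (volume.restrict Ω.carrier) :=
  LinearMap.mkContinuous
    { toFun := fun u => u.memLp_domain.toLp _
      map_add' := fun u v => by
        rw [← MemLp.toLp_add]
        exact MemLp.toLp_congr _ _ (ae_restrict_of_ae (AEEqFun.coeFn_add u.toFun v.toFun))
      map_smul' := fun c u => by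
        rw [RingHom.id_apply, ← MemLp.toLp_const_smul]
        exact MemLp.toLp_congr _ _ (ae_restrict_of_ae (AEEqFun.coeFn_smul c u.toFun)) }
    1 fun u => by
      rw [one_mul]
      exact (Lp.norm_toLp _ u.memLp_domain).trans_le u.nΩ_le_norm

theorem A_eq (u : SpaceX Ω s p) : A u = ‖quotL u‖ ^ p := by
  have h0 : 0 < p := by linarith [hp.out]
  rw [norm_quotL, A, gagliardoSeminorm, gagliardoEnergy_eq Ω s hp.out, ← ENNReal.toReal_rpow,
    ← Real.rpow_mul ENNReal.toReal_nonneg, mul_one_div_cancel h0.ne', Real.rpow_one]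
  rfl

theorem hasFDerivAt_A (u : SpaceX Ω s p) :
    HasFDerivAt A ((normRpowDeriv (quotL u)).comp quotL) u := by
  have e : (A : SpaceX Ω s p → ℝ) = (fun f => ‖f‖ ^ p) ∘ quotL := funext A_eq
  rw [e]
  exact (hasFDerivAt_norm_rpow_Lp (quotL u)).comp u quotL.hasFDerivAt

instance isFiniteMeasure_domain (Ω : LipschitzDomain N) :
    IsFiniteMeasure (volume.restrict Ω.carrier) :=
  isFiniteMeasure_restrict.2 Ω.isBounded.measure_lt_top.ne

theorem domain_real_pos (Ω : LipschitzDomain N) :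
    0 < (volume.restrict Ω.carrier).real univ := by
  rw [measureReal_restrict_apply_univ, Measure.real]
  exact ENNReal.toReal_pos (Ω.isOpen.measure_pos volume Ω.isConnected.nonempty).ne'
    Ω.isBounded.measure_lt_top.ne

/-- The functional `u ↦ ∫_Ω u` on `X`. -/
noncomputable def integralL : StrongDual ℝ (SpaceX Ω s p) :=
  ((ContinuousLinearMap.mul ℝ ℝ).lpPairing (volume.restrict Ω.carrier)
    (ENNReal.ofReal (p / (p - 1))) (ENNReal.ofReal p)
    ((memLp_const (1 : ℝ)).toLp fun _ => 1)).comp restrictL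

theorem integralL_apply (u : SpaceX Ω s p) :
    integralL u = ∫ x in Ω.carrier, u.toFun x := by
  rw [integralL, ContinuousLinearMap.comp_apply, ContinuousLinearMap.lpPairing_eq_integral]
  refine integral_congr_ae ?_
  have h1 := MemLp.coeFn_toLp (memLp_const (μ := volume.restrict Ω.carrier)
    (p := ENNReal.ofReal (p / (p - 1))) (1 : ℝ))
  have h2 := MemLp.coeFn_toLp u.memLp_domain
  filter_upwards [h1, h2] with x hx1 hx2
  rw [ContinuousLinearMap.mul_apply', hx1, one_mul]
  exact hx2

theorem eLpNorm_diff_le (hs : 0 < s) (u : SpaceX Ω s p) :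
    eLpNorm (fun z : EuclideanSpace ℝ (Fin N) × EuclideanSpace ℝ (Fin N) =>
        u.toFun z.1 - u.toFun z.2) (ENNReal.ofReal p)
        ((volume.restrict Ω.carrier).prod (volume.restrict Ω.carrier))
      ≤ ENNReal.ofReal (Metric.diam Ω.carrier ^ (((N : ℝ) + p * s) / p))
        * eLpNorm (quot s p u.toFun) (ENNReal.ofReal p) (volume.restrict (Q Ω)) := by
  have h0 : 0 < p := by linarith [hp.out]
  have hsub : Ω.carrier ×ˢ Ω.carrier ⊆ Q Ω := fun z hz hz' => hz'.1 hz.1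
  rw [Measure.prod_restrict, ← Measure.volume_eq_prod]
  refine le_trans ?_ (mul_le_mul_right (eLpNorm_mono_measure (quot s p u.toFun)
    (Measure.restrict_mono_set volume hsub)) _)
  refine eLpNorm_le_mul_eLpNorm_of_ae_le_mul ?_ _
  refine ae_restrict_of_forall_mem (Ω.isOpen.measurableSet.prod Ω.isOpen.measurableSet) ?_
  rintro ⟨x, y⟩ ⟨hx, hy⟩
  -- on the diagonal `quot` is `0 / 0 = 0`, but the difference vanishes there too
  rcases eq_or_ne x y with rfl | hxy
  · simp only [sub_self, norm_zero]
    positivity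
  · have hd : 0 < ‖x - y‖ := norm_pos_iff.2 (sub_ne_zero.2 hxy)
    have hw : 0 < ‖x - y‖ ^ (((N : ℝ) + p * s) / p) := Real.rpow_pos_of_pos hd _
    have hle : ‖x - y‖ ^ (((N : ℝ) + p * s) / p)
        ≤ Metric.diam Ω.carrier ^ (((N : ℝ) + p * s) / p) := by
      refine Real.rpow_le_rpow hd.le ?_ (by positivity)
      rw [← dist_eq_norm]
      exact Metric.dist_le_diam_of_mem Ω.isBounded hx hy
    simp only [quot, norm_div, Real.norm_eq_abs]
    rw [abs_of_pos hw, ← mul_div_assoc, le_div_iff₀ hw, mul_comm]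
    gcongr

/-- Poincaré inequality on `X`. It holds because the weight `|x - y| ^ (-(N + ps))` is bounded below
on the bounded set `Ω × Ω`, so `nQ` controls the differences of `u` in `L^p(Ω × Ω)`, and hence the
deviation of `u` from its mean over `Ω`. -/
theorem exists_nΩ_le (hs : 0 < s) :
    ∃ C : ℝ, 0 ≤ C ∧ ∀ u : SpaceX Ω s p, u.nΩ ≤ C * (u.nQ + |integralL u|) := by
  have h0 : 0 < p := by linarith [hp.out]
  set μ : Measure (EuclideanSpace ℝ (Fin N)) := volume.restrict Ω.carrier with hμ
  set V := μ.real univ with hV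
  have hVpos : 0 < V := domain_real_pos Ω
  set D := Metric.diam Ω.carrier ^ (((N : ℝ) + p * s) / p) with hD
  have hD0 : 0 ≤ D := Real.rpow_nonneg Metric.diam_nonneg _
  set a := V ^ (1 - 1 / p) * D with ha
  set b := V ^ (1 / p) with hb
  have ha0 : 0 ≤ a := by positivity
  have hb0 : 0 ≤ b := by positivity
  refine ⟨(a + b) / V, by positivity, fun u => ?_⟩
  set m := ∫ x, u.toFun x ∂μ with hm
  have hp1 : (1 : ℝ≥0∞) ≤ ENNReal.ofReal p := by simpa using hp.out.le
  have hmeas : Measurable u.toFun := u.toFun.measurable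
  have hosc := (eLpNorm_sub_integral_le μ hp.out hmeas (u.memLp_domain.integrable hp1)).trans
    (mul_le_mul_right (eLpNorm_diff_le hs u) _)
  have htri : ‖V‖ₑ * eLpNorm u.toFun (ENNReal.ofReal p) μ
      ≤ eLpNorm (fun x => V * u.toFun x - m) (ENNReal.ofReal p) μ
        + eLpNorm (fun _ => m) (ENNReal.ofReal p) μ := by
    rw [← eLpNorm_const_smul]
    refine le_trans (le_of_eq ?_) (eLpNorm_add_le (by fun_prop) (by fun_prop) hp1)
    congr 1
    funext x
    simp
  have hconst : eLpNorm (fun _ : EuclideanSpace ℝ (Fin N) => m) (ENNReal.ofReal p) μ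
      = ‖m‖ₑ * μ univ ^ (1 / p) := by
    rw [eLpNorm_const' _ (by simpa using h0) ENNReal.ofReal_ne_top, ENNReal.toReal_ofReal h0.le]
  have hfin : μ univ ≠ ∞ := measure_ne_top _ _
  have hexp : 0 ≤ 1 - 1 / p := by
    rw [sub_nonneg, div_le_one h0]
    exact hp.out.le
  have total := htri.trans (add_le_add hosc hconst.le)
  have hR := ENNReal.toReal_mono ?_ total
  · rw [ENNReal.toReal_add, ENNReal.toReal_mul, ENNReal.toReal_mul, ENNReal.toReal_mul,
      ENNReal.toReal_mul, ← ENNReal.toReal_rpow, ← ENNReal.toReal_rpow,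
      ENNReal.toReal_ofReal hD0, toReal_enorm, toReal_enorm, Real.norm_eq_abs, Real.norm_eq_abs,
      abs_of_pos hVpos] at hR
    · change V * u.nΩ ≤ V ^ (1 - 1 / p) * (D * u.nQ) + |m| * b at hR
      rw [integralL_apply, div_mul_eq_mul_div, le_div_iff₀ hVpos]
      change u.nΩ * V ≤ (a + b) * (u.nQ + |m|)
      have h1 := u.nQ_nonneg
      have h2 := abs_nonneg m
      have h3 : 0 ≤ b * u.nQ := by positivity
      have h4 : 0 ≤ a * |m| := by positivity
      have h5 : V ^ (1 - 1 / p) * (D * u.nQ) = a * u.nQ := by rw [ha]; ring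
      linarith
    · exact ENNReal.mul_ne_top (ENNReal.rpow_ne_top_of_nonneg hexp hfin)
        (ENNReal.mul_ne_top ENNReal.ofReal_ne_top u.finite_Q.ne)
    · exact ENNReal.mul_ne_top enorm_ne_top
        (ENNReal.rpow_ne_top_of_nonneg (by positivity) hfin)
  · exact ENNReal.add_ne_top.2 ⟨ENNReal.mul_ne_top (ENNReal.rpow_ne_top_of_nonneg hexp hfin)
        (ENNReal.mul_ne_top ENNReal.ofReal_ne_top u.finite_Q.ne),
      ENNReal.mul_ne_top enorm_ne_top (ENNReal.rpow_ne_top_of_nonneg (by positivity) hfin)⟩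

theorem hasSPlus_fderiv_A (hs : 0 < s) : HasSPlus (fderiv ℝ (A : SpaceX Ω s p → ℝ)) := by
  intro v u hw hl
  have hA : ∀ x y : SpaceX Ω s p, fderiv ℝ A x y = normRpowDeriv (quotL x) (quotL y) :=
    fun x y => by rw [(hasFDerivAt_A x).fderiv]; rfl
  have hw0 : ∀ φ : StrongDual ℝ (SpaceX Ω s p),
      Tendsto (fun n => φ (v n - u)) atTop (𝓝 0) := fun φ => by
    simpa [map_sub] using (hw φ).sub_const (φ u)
  obtain ⟨K, hK⟩ := exists_norm_le_of_tendsto_weak hw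
  have hq : Tendsto (fun n => quotL (v n)) atTop (𝓝 (quotL u)) := by
    refine tendsto_of_limsup_normRpowDeriv_le (K := K)
      (fun n => (norm_quotL (v n)).trans_le ((nQ_le_norm _).trans (hK n))) ?_ ?_
    · simpa only [hA, map_sub] using hw0 (fderiv ℝ A u)
    · simpa only [hA, map_sub] using hl
  have hnQ : Tendsto (fun n => (v n - u).nQ) atTop (𝓝 0) := by
    have := tendsto_iff_norm_sub_tendsto_zero.1 hq
    simpa only [← map_sub, norm_quotL] using this
  obtain ⟨C, -, hC⟩ := exists_nΩ_le (Ω := Ω) (p := p) hs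
  have hbound : Tendsto (fun n => (v n - u).nQ + C * ((v n - u).nQ + |integralL (v n - u)|))
      atTop (𝓝 0) := by
    simpa using hnQ.add ((hnQ.add (hw0 integralL).abs).const_mul C)
  rw [tendsto_iff_norm_sub_tendsto_zero]
  exact squeeze_zero (fun n => norm_nonneg _)
    (fun n => (norm_le_add _).trans (by gcongr; exact hC _)) hbound

end SpaceX

end NeumannFrac

theorem proposition3p1 {N : ℕ} (hN : 1 ≤ N) (Ω : NeumannFrac.LipschitzDomain N)
    (s p : ℝ) (hs : 0 < s) (hs' : s < 1) [Fact (1 < p)] :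
    Differentiable ℝ (NeumannFrac.SpaceX.A : NeumannFrac.SpaceX Ω s p → ℝ) ∧
      NeumannFrac.HasSPlus
        (fderiv ℝ (NeumannFrac.SpaceX.A : NeumannFrac.SpaceX Ω s p → ℝ)) :=
  ⟨fun u => (NeumannFrac.SpaceX.hasFDerivAt_A u).differentiableAt,
    NeumannFrac.SpaceX.hasSPlus_fderiv_A hs⟩
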